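/- Let $n$ be a non-negative integer (the dimension), let $M$ be a smooth $n$-dimensional manifold without boundary and let $F : M \to \mathbb{R}^{n+1}$ be a proper smooth immersion (so that the induced metric is complete) which is a self-shrinker: around every point of $M$ there is a smooth unit normal field $\nu$ of $F$ with $H = \frac{\langle x, \nu\rangle}{2}$, where $x = F$ is the position vector and $H = \operatorname{div}(\nu)$ is the mean curvature, i.e. $H=\sum_{i=1}^n \langle d\nu(u_i), dF(u_i)\rangle$ for tangent vectors $u_1,\dots,u_n$ of $M$ whose images $dF(u_i)$ are orthonormal. (The equation is unchanged if $\nu$ is replaced by $-\nu$.) Put $\Sigma = F(M)$. For $r>0$ let $B(0,r)$ be the open ball and $S(0,r)$ the sphere of radius $r$ centred at the origin of $\mathbb{R}^{n+1}$, and for $q,v\in\mathbb{R}^{n+1}$ let $L(q,v)=\{q+tv : t\ge 0\}$. For $p\in S(0,r)$ define $$U_r(p) = \{q \in \mathbb{R}^{n+1}\setminus B(0,r) : L(q,-p) \cap S(0,\sqrt{2n}) \neq \varnothing \},$$ and put $$V_r = \bigcup_{p\in S(0,r),\ U_r(p) \cap \Sigma\cap S(0,r)=\varnothing} U_r(p),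 \qquad X_r = \mathbb{R}^{n+1} \setminus (B(0,r) \cup V_r).$$ Then for every $r>\sqrt{2n}$, $$\Sigma\setminus B(0,r) \subset X_r .$$ -/

import Mathlib

open Set Metric
open scoped Manifold ContDiff InnerProductSpace

/-- The ambient Euclidean space `ℝⁿ⁺¹`. -/
abbrev Ambient (n : ℕ) : Type := EuclideanSpace ℝ (Fin (n + 1))

section Hypersurfaces

variable {n : ℕ} {M : Type*} [TopologicalSpace M] [ChartedSpace (EuclideanSpace ℝ (Fin n)) M]

/-- `ν` is a smooth unit normal field, on the set `U ⊆ M`, of the map `F : M → ℝⁿ⁺¹`. -/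
structure IsUnitNormalOn (F ν : M → Ambient n) (U : Set M) : Prop where
  smooth : ContMDiffOn (𝓡 n) 𝓘(ℝ, Ambient n) ∞ ν U
  norm_eq_one : ∀ x ∈ U, ‖ν x‖ = 1
  orthogonal : ∀ x ∈ U, ∀ v : TangentSpace (𝓡 n) x,
    ⟪mvfderiv (𝓡 n) F x v, ν x⟫_ℝ = 0

/-- At the point `x`, the mean curvature `div ν` of the immersion `F` with respect to the unit
normal field `ν` is the number `H`. Here `div` is the divergence along the hypersurface: for any
`u₁, …, uₙ` in `T_x M` whose images `dF(uᵢ)` form an orthonormal basis of the tangent hyperplane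
`dF(T_x M)`, it is the sum of the numbers `⟨dν(uᵢ), dF(uᵢ)⟩`. -/
def HasMeanCurvature (F ν : M → Ambient n) (x : M) (H : ℝ) : Prop :=
  ∀ u : Fin n → TangentSpace (𝓡 n) x,
    Orthonormal ℝ (fun i => mvfderiv (𝓡 n) F x (u i)) →
      ∑ i, ⟪mvfderiv (𝓡 n) ν x (u i), mvfderiv (𝓡 n) F x (u i)⟫_ℝ = H

/-- `F : M → ℝⁿ⁺¹` is a properly immersed self-shrinker: a smooth proper immersion of the
`n`-manifold `M` (without boundary) satisfying `H = ⟨x, ν⟩ / 2`. The equation does not change when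
`ν` is replaced by `-ν`, so it is required for a local smooth unit normal field around each point
of `M`. (The metric induced by a proper immersion is complete.) -/
structure IsProperlyImmersedSelfShrinker (F : M → Ambient n) : Prop where
  smooth : ContMDiff (𝓡 n) 𝓘(ℝ, Ambient n) ∞ F
  immersion : ∀ x : M, Function.Injective (mvfderiv (𝓡 n) F x)
  proper : IsProperMap F
  shrinker : ∀ x₀ : M, ∃ (U : Set M) (ν : M → Ambient n), IsOpen U ∧ x₀ ∈ U ∧
    IsUnitNormalOn F ν U ∧ ∀ x ∈ U, HasMeanCurvature F ν x (⟪F x, ν x⟫_ℝ / 2)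

end Hypersurfaces

section Regions

variable {n : ℕ}

/-- The half-line `L(q, v)` beginning at `q` with direction `v`. -/
def halfLine (q v : Ambient n) : Set (Ambient n) := {y | ∃ t : ℝ, 0 ≤ t ∧ y = q + t • v}

/-- The shadow `U_r(p)`: the points `q` outside the open ball `B(0,r)` such that the half-line
`L(q, -p)` meets the sphere `S(0, √(2n))`. -/
def shadow (r : ℝ) (p : Ambient n) : Set (Ambient n) :=
  {q | q ∉ ball 0 r ∧ (halfLine q (-p) ∩ sphere 0 √(2 * (n : ℝ))).Nonempty}

/-- `V_r`: the union of the shadows `U_r(p)`, `p ∈ S(0,r)`, not meeting `S ∩ S(0,r)`. -/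
def shadowUnion (S : Set (Ambient n)) (r : ℝ) : Set (Ambient n) :=
  ⋃ p ∈ {p : Ambient n | p ∈ sphere 0 r ∧ shadow r p ∩ (S ∩ sphere 0 r) = ∅}, shadow r p

/-- `X_r = ℝⁿ⁺¹ \ (B(0,r) ∪ V_r)`. -/
def allowedRegion (S : Set (Ambient n)) (r : ℝ) : Set (Ambient n) :=
  (ball 0 r ∪ shadowUnion S r)ᶜ

end Regions

open Filter Topology

/-! Suppose `q ∈ Σ` lies in a shadow `U_r(p)` that misses `Σ ∩ S(0,r)`. A ball of radius `ρ`
slightly above `√(2n)` moves from the origin in direction `p`. It never meets `Σ ∩ S(0,r)`, yet it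
reaches `q`, so it first touches `Σ \ B(0,r)` at some `x` with `‖x‖ > r`, on its front half
(`exists_first_touching`, `norm_eq_and_inner_nonneg_of_first_touching`). With centre `a = s • p`,
comparing `Σ` with the sphere at `x` and using `H = ⟨x,ν⟩/2` gives `⟨x, x - a⟩ ≤ 2n`
(`inner_le_of_isLocalMin`). But `⟨x, x - a⟩ = ρ² + s⟨p, x - a⟩ ≥ ρ² > 2n`. -/

/-- If `c < 0`, then `t` is also a local maximum, so `f` is locally constant and `c = 0`. -/
theorem IsLocalMin.nonneg_of_hasDerivAt {f h : ℝ → ℝ} {t c : ℝ} (hmin : IsLocalMin f t)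
    (hf : ∀ᶠ s in 𝓝 t, HasDerivAt f (h s) s) (hh : HasDerivAt h c t) : 0 ≤ c := by
  by_contra! hc
  have hd : deriv f =ᶠ[𝓝 t] h := hf.mono fun s hs => hs.deriv
  have hdd : deriv (deriv f) t = c := by rw [hd.deriv_eq, hh.deriv]
  have hmax : IsLocalMax f t :=
    isLocalMax_of_deriv_deriv_neg (hdd ▸ hc) hmin.deriv_eq_zero hf.self_of_nhds.continuousAt
  have hconst : f =ᶠ[𝓝 t] fun _ => f t := by
    filter_upwards [hmin, hmax] with s h₁ h₂ using le_antisymm h₂ h₁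
  have h0 : deriv f =ᶠ[𝓝 t] fun _ => 0 := by
    simpa using hconst.deriv
  have : c = 0 := by rw [← hdd, h0.deriv_eq, deriv_const]
  exact hc.ne this

/-! ### Second-order comparison along a curve. -/

section Curve

variable {V : Type*} [NormedAddCommGroup V] [InnerProductSpace ℝ V]

/-- If a curve `g`, orthogonal to the field `ν` along it, is locally closest to `a` at a time when
`g - a` is a multiple of `ν`, then it curves away from `a` less than the sphere about `a`. -/
theorem inner_deriv_le_of_isLocalMin {g ν : ℝ → V} {a : V} {t c : ℝ} (hg : ContDiffAt ℝ 2 g t)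
    (hν : DifferentiableAt ℝ ν t) (horth : ∀ᶠ s in 𝓝 t, ⟪deriv g s, ν s⟫_ℝ = 0)
    (hmin : IsLocalMin (fun s => ‖g s - a‖ ^ 2) t) (hc : g t - a = c • ν t) :
    c * ⟪deriv ν t, deriv g t⟫_ℝ ≤ ⟪deriv g t, deriv g t⟫_ℝ := by
  have hd : ∀ᶠ s in 𝓝 t, DifferentiableAt ℝ g s :=
    (hg.eventually (by simp)).mono fun s hs => hs.differentiableAt (by norm_num)
  have hdd : DifferentiableAt ℝ (deriv g) t := by
    have : ContDiffAt ℝ 1 (deriv g) t := hg.derivWithin (m := 1) (by norm_num)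
    exact this.differentiableAt (by norm_num)
  -- Subtracting `c • ν s` changes nothing by orthogonality, but makes the left factor vanish at
  -- `t`, so `g''` drops out of the second derivative.
  have hf : ∀ᶠ s in 𝓝 t, HasDerivAt (fun s => ‖g s - a‖ ^ 2)
      (2 * ⟪g s - a - c • ν s, deriv g s⟫_ℝ) s := by
    filter_upwards [hd, horth] with s hs ho
    have := (hs.hasDerivAt.sub_const a).norm_sq
    convert! this using 1
    rw [inner_sub_left, real_inner_smul_left, real_inner_comm _ (ν s), ho, mul_zero, sub_zero]
  have hh : HasDerivAt (fun s => 2 * ⟪g s - a - c • ν s, deriv g s⟫_ℝ)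
      (2 * ⟪deriv g t - c • deriv ν t, deriv g t⟫_ℝ) t := by
    have h₁ := ((hd.self_of_nhds.hasDerivAt.sub_const a).sub
      (hν.hasDerivAt.const_smul c)).inner ℝ hdd.hasDerivAt
    convert! h₁.const_mul 2 using 1
    simp [hc]
  have := hmin.nonneg_of_hasDerivAt hf hh
  rw [inner_sub_left, real_inner_smul_left] at this
  linarith

end Curve

/-! ### Curves with prescribed velocity. -/

section Manifold

variable {n : ℕ} {M : Type*} [TopologicalSpace M] [ChartedSpace (EuclideanSpace ℝ (Fin n)) M]
  {V : Type*} [NormedAddCommGroup V] [InnerProductSpace ℝ V]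

theorem deriv_comp_curve {f : M → V} {γ : ℝ → M} {t : ℝ}
    (hf : MDifferentiableAt (𝓡 n) 𝓘(ℝ, V) f (γ t))
    (hγ : MDifferentiableAt 𝓘(ℝ, ℝ) (𝓡 n) γ t) :
    deriv (f ∘ γ) t = mvfderiv (𝓡 n) f (γ t) (mfderiv 𝓘(ℝ, ℝ) (𝓡 n) γ t (1 : ℝ)) := by
  rw [← fderiv_apply_one_eq_deriv, ← mfderiv_eq_fderiv]
  exact mfderiv_comp_apply t hf hγ (1 : ℝ)

theorem exists_curve_mfderiv_eq [IsManifold (𝓡 n) ∞ M] (m : M) (v : TangentSpace (𝓡 n) m) :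
    ∃ γ : ℝ → M, γ 0 = m ∧ (∀ᶠ t in 𝓝 0, ContMDiffAt 𝓘(ℝ, ℝ) (𝓡 n) ∞ γ t) ∧
      (mfderiv 𝓘(ℝ, ℝ) (𝓡 n) γ 0 (1 : ℝ) : EuclideanSpace ℝ (Fin n)) = v := by
  have : IsManifold (𝓡 n) 1 M := IsManifold.of_le (n := ∞) (by simp)
  let w : EuclideanSpace ℝ (Fin n) := v
  let ℓ : ℝ → EuclideanSpace ℝ (Fin n) := fun t => extChartAt (𝓡 n) m m + t • w
  have hℓ : ContDiff ℝ ∞ ℓ := by fun_prop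
  have hℓ0 : ℓ 0 = extChartAt (𝓡 n) m m := by simp [ℓ]
  have hsmooth : ∀ᶠ t in 𝓝 (0 : ℝ),
      ContMDiffAt 𝓘(ℝ, ℝ) (𝓡 n) ∞ ((extChartAt (𝓡 n) m).symm ∘ ℓ) t := by
    have hmem : ∀ᶠ t in 𝓝 (0 : ℝ), ℓ t ∈ (extChartAt (𝓡 n) m).target := by
      apply hℓ.continuous.continuousAt.eventually_mem
      rw [hℓ0]
      exact extChartAt_target_mem_nhds m
    filter_upwards [hmem] with t ht
    exact (((contMDiffOn_extChartAt_symm m).contMDiffAt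
      ((isOpen_extChartAt_target m).mem_nhds ht))).comp t hℓ.contMDiff.contMDiffAt
  refine ⟨(extChartAt (𝓡 n) m).symm ∘ ℓ, by simp [ℓ], hsmooth, ?_⟩
  have hs : MDifferentiableAt 𝓘(ℝ, EuclideanSpace ℝ (Fin n)) (𝓡 n) (extChartAt (𝓡 n) m).symm
      (ℓ 0) := by
    rw [hℓ0]
    exact ((contMDiffOn_extChartAt_symm (n := ∞) m).contMDiffAt
      (extChartAt_target_mem_nhds m)).mdifferentiableAt (by simp)
  have hd : mfderiv 𝓘(ℝ, ℝ) 𝓘(ℝ, EuclideanSpace ℝ (Fin n)) ℓ 0 (1 : ℝ) = w := by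
    rw [mfderiv_eq_fderiv]
    have : HasDerivAt ℓ w 0 := by
      have := ((hasDerivAt_id (0 : ℝ)).smul_const w).const_add (extChartAt (𝓡 n) m m)
      rwa [one_smul] at this
    exact (fderiv_apply_one_eq_deriv (f := ℓ) (x := 0)).trans this.deriv
  refine (mfderiv_comp_apply 0 hs (hℓ.contMDiff.mdifferentiable (by simp) 0) (1 : ℝ)).trans ?_
  rw [hd, hℓ0]
  have := mfderivWithin_range_extChartAt_symm (I := 𝓡 n) (x := m)
  simp only [modelWithCornersSelf_coe, Set.range_id, mfderivWithin_univ] at this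
  exact congrArg (fun A : EuclideanSpace ℝ (Fin n) →L[ℝ] EuclideanSpace ℝ (Fin n) => A w) this

end Manifold

/-! ### Linear algebra of the tangent hyperplane. -/

section Hyperplane

variable {n : ℕ}

theorem eq_inner_smul_of_orthogonal_hyperplane {W : Submodule ℝ (Ambient n)}
    (hW : Module.finrank ℝ W = n) {ν w : Ambient n} (hν : ‖ν‖ = 1) (hνW : ν ∈ Wᗮ)
    (hw : w ∈ Wᗮ) : w = ⟪ν, w⟫_ℝ • ν := by
  have h1 : Module.finrank ℝ Wᗮ = 1 :=
    W.finrank_add_finrank_orthogonal' (by simp [hW])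
  have hne : (⟨ν, hνW⟩ : Wᗮ) ≠ 0 := by
    intro h
    have : ν = 0 := congrArg Subtype.val h
    simp [this] at hν
  obtain ⟨c, hc⟩ := (finrank_eq_one_iff_of_nonzero' _ hne).1 h1 ⟨w, hw⟩
  have hc : c • ν = w := congrArg Subtype.val hc
  rw [← hc, inner_smul_right, real_inner_self_eq_norm_sq, hν]
  simp

theorem exists_orthonormal_image {E : Type*} [AddCommGroup E] [Module ℝ E]
    (L : E →ₗ[ℝ] Ambient n) (h : Module.finrank ℝ (LinearMap.range L) = n) :
    ∃ u : Fin n → E, Orthonormal ℝ fun i => L (u i) := by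
  let b := (stdOrthonormalBasis ℝ (LinearMap.range L)).reindex (finCongr h)
  choose u hu using fun i => (b i).2
  refine ⟨u, ?_⟩
  simp only [hu]
  exact b.orthonormal.comp_linearIsometry (LinearMap.range L).subtypeₗᵢ

end Hyperplane

/-! ### Touching spheres and the shrinker equation. -/

section Shrinker

variable {n : ℕ} {M : Type*} [TopologicalSpace M] [ChartedSpace (EuclideanSpace ℝ (Fin n)) M]
  [IsManifold (𝓡 n) ∞ M]

theorem IsUnitNormalOn.inner_mvfderiv_le {F ν : M → Ambient n} {U : Set M} (hU : IsOpen U)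
    (hF : ContMDiff (𝓡 n) 𝓘(ℝ, Ambient n) ∞ F) (hν : IsUnitNormalOn F ν U) {m : M} (hm : m ∈ U)
    {a : Ambient n} {c : ℝ} (hmin : IsLocalMin (fun x => ‖F x - a‖ ^ 2) m)
    (hc : F m - a = c • ν m) (v : TangentSpace (𝓡 n) m) :
    c * ⟪mvfderiv (𝓡 n) ν m v, mvfderiv (𝓡 n) F m v⟫_ℝ ≤
      ⟪mvfderiv (𝓡 n) F m v, mvfderiv (𝓡 n) F m v⟫_ℝ := by
  obtain ⟨γ, h0, hγ, hv⟩ := exists_curve_mfderiv_eq m v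
  subst h0
  have hγc : ContinuousAt γ 0 := hγ.self_of_nhds.continuousAt
  have hγU : ∀ᶠ t in 𝓝 0, γ t ∈ U := hγc.eventually_mem (hU.mem_nhds hm)
  have hνs := hν.smooth.contMDiffAt (hU.mem_nhds hm)
  have hγd := hγ.mono fun t ht => ht.mdifferentiableAt (by simp)
  have hFd := hF.mdifferentiable (by simp)
  have dF := deriv_comp_curve (hFd (γ 0)) hγd.self_of_nhds
  have dν := deriv_comp_curve (hνs.mdifferentiableAt (by simp)) hγd.self_of_nhds
  have hv' : mfderiv 𝓘(ℝ, ℝ) (𝓡 n) γ 0 (1 : ℝ) = v := hv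
  rw [hv'] at dF dν
  rw [← dF, ← dν]
  refine inner_deriv_le_of_isLocalMin (a := a) ?_ ?_ ?_ ?_ hc
  · exact ((hF.contMDiffAt.comp 0 hγ.self_of_nhds).contDiffAt).of_le
      (WithTop.coe_le_coe.2 le_top)
  · exact ((hνs.comp 0 hγ.self_of_nhds).contDiffAt).differentiableAt (by simp)
  · filter_upwards [hγU, hγd] with t ht hd
    rw [deriv_comp_curve (hFd (γ t)) hd]
    exact hν.orthogonal _ ht _
  · exact hγc.eventually hmin

theorem mvfderiv_inner_eq_zero_of_isLocalMin {F : M → Ambient n}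
    (hF : ContMDiff (𝓡 n) 𝓘(ℝ, Ambient n) ∞ F) {m : M} {a : Ambient n}
    (hmin : IsLocalMin (fun x => ‖F x - a‖ ^ 2) m) (v : TangentSpace (𝓡 n) m) :
    ⟪mvfderiv (𝓡 n) F m v, F m - a⟫_ℝ = 0 := by
  obtain ⟨γ, h0, hγ, hv⟩ := exists_curve_mfderiv_eq m v
  subst h0
  have hs := hγ.self_of_nhds
  have hd : DifferentiableAt ℝ (F ∘ γ) 0 :=
    ((hF.contMDiffAt.comp 0 hs).contDiffAt).differentiableAt (by simp)
  have dF := deriv_comp_curve (hF.mdifferentiable (by simp) (γ 0))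
    (hs.mdifferentiableAt (by simp))
  have hv' : mfderiv 𝓘(ℝ, ℝ) (𝓡 n) γ 0 (1 : ℝ) = v := hv
  rw [hv'] at dF
  have hmin' : IsLocalMin (fun t => ‖(F ∘ γ) t - a‖ ^ 2) 0 := hs.continuousAt.eventually hmin
  have := hmin'.hasDerivAt_eq_zero (hd.hasDerivAt.sub_const a).norm_sq
  rw [dF, real_inner_comm] at this
  simpa using this

/-- Comparison of a self-shrinker with a sphere about `a` that it touches from outside. -/
theorem IsProperlyImmersedSelfShrinker.inner_le_of_isLocalMin {F : M → Ambient n}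
    (hF : IsProperlyImmersedSelfShrinker F) {m : M} {a : Ambient n}
    (hmin : IsLocalMin (fun x => ‖F x - a‖ ^ 2) m) : ⟪F m, F m - a⟫_ℝ ≤ 2 * n := by
  obtain ⟨U, ν, hU, hm, hν, hH⟩ := hF.shrinker m
  let L : EuclideanSpace ℝ (Fin n) →ₗ[ℝ] Ambient n := (mvfderiv (𝓡 n) F m).toLinearMap
  have hL : Module.finrank ℝ (LinearMap.range L) = n :=
    (LinearMap.finrank_range_of_inj (hF.immersion m)).trans finrank_euclideanSpace_fin
  have horth {w : Ambient n} (hw : ∀ v, ⟪L v, w⟫_ℝ = 0) : w ∈ (LinearMap.range L)ᗮ := by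
    rintro _ ⟨v, rfl⟩
    exact hw v
  have hc := eq_inner_smul_of_orthogonal_hyperplane hL (hν.norm_eq_one m hm)
    (horth (hν.orthogonal m hm)) (horth (mvfderiv_inner_eq_zero_of_isLocalMin hF.smooth hmin))
  set c := ⟪ν m, F m - a⟫_ℝ
  obtain ⟨u, hu⟩ := exists_orthonormal_image L hL
  -- Summing the comparison over an orthonormal frame gives `c * H ≤ n`, whatever the sign of `c`.
  have hsum : c * (⟪F m, ν m⟫_ℝ / 2) ≤ n := by
    rw [← hH m hm u hu, Finset.mul_sum]
    calc _ ≤ ∑ i, ⟪L (u i), L (u i)⟫_ℝ :=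
          Finset.sum_le_sum fun i _ => hν.inner_mvfderiv_le hU hF.smooth hm hmin hc (u i)
      _ = n := by simp [hu.1]
  rw [hc, inner_smul_right]
  linarith

end Shrinker

/-! ### The moving ball and its first contact. -/

section MovingSphere

variable {n : ℕ}

theorem exists_mem_sphere_of_segment {q p : Ambient n} {R t : ℝ} (ht : 0 ≤ t) (hq : R ≤ ‖q‖)
    (h : ‖q - t • p‖ ≤ R) : (halfLine q (-p) ∩ sphere 0 R).Nonempty := by
  have hcont : ContinuousOn (fun s : ℝ => ‖q + s • -p‖) (Icc 0 t) := by fun_prop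
  obtain ⟨s, hs, hsR⟩ := intermediate_value_Icc' ht hcont
    (show R ∈ Icc _ _ by simpa [← sub_eq_add_neg] using ⟨h, hq⟩)
  exact ⟨q + s • -p, ⟨s, hs.1, rfl⟩, by simpa using hsR⟩

/-- Compactness of `K × [0,T]` leaves room to enlarge the radius strictly; this makes the final
contradiction strict. -/
theorem exists_radius_gt {K : Set (Ambient n)} (hK : IsCompact K) (p : Ambient n)
    {R r T : ℝ} (hr : R < r) (h : ∀ q ∈ K, ∀ t ∈ Icc 0 T, R < ‖q - t • p‖) :
    ∃ ρ, R < ρ ∧ ρ < r ∧ ∀ q ∈ K, ∀ t ∈ Icc 0 T, ρ < ‖q - t • p‖ := by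
  rcases (K ×ˢ Icc (0 : ℝ) T).eq_empty_or_nonempty with he | hne
  · obtain ⟨ρ, h₁, h₂⟩ := exists_between hr
    refine ⟨ρ, h₁, h₂, fun q hq t ht => ?_⟩
    have : (q, t) ∈ K ×ˢ Icc (0 : ℝ) T := ⟨hq, ht⟩
    simp [he] at this
  · have hc : ContinuousOn (fun x : Ambient n × ℝ => ‖x.1 - x.2 • p‖) (K ×ˢ Icc (0 : ℝ) T) := by
      fun_prop
    obtain ⟨x, hx, hmin⟩ := (hK.prod isCompact_Icc).exists_isMinOn hne hc
    obtain ⟨ρ, h₁, h₂⟩ := exists_between (lt_min hr (h x.1 hx.1 x.2 hx.2))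
    rw [lt_min_iff] at h₂
    exact ⟨ρ, h₁, h₂.1, fun q hq t ht => h₂.2.trans_le (isMinOn_iff.1 hmin (q, t) ⟨hq, ht⟩)⟩

/-- Balls of radius `ρ < r` move from the origin in the direction `p` until they touch the part
of `S` outside `B(0,r)` for the first time, with centre `s • p`. -/
theorem exists_first_touching {S : Set (Ambient n)} (hS : IsClosed S) {p : Ambient n} {r ρ T : ℝ}
    (hρ : ρ < r) {q : Ambient n} (hq : q ∈ S) (hqr : r ≤ ‖q‖) (hT : 0 ≤ T)
    (hqT : ‖q - T • p‖ ≤ ρ) :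
    ∃ s ∈ Ioc 0 T, ∃ x ∈ S, r ≤ ‖x‖ ∧ ‖x - s • p‖ ≤ ρ ∧
      ∀ t ∈ Ico 0 s, ∀ y ∈ S, r ≤ ‖y‖ → ρ < ‖y - t • p‖ := by
  let A : Set (ℝ × Ambient n) :=
    {z | z.1 ∈ Icc 0 T ∧ z.2 ∈ S ∧ r ≤ ‖z.2‖ ∧ ‖z.2 - z.1 • p‖ ≤ ρ}
  have hclosed : IsClosed A := by
    refine (isClosed_Icc.preimage continuous_fst).inter
      ((hS.preimage continuous_snd).inter (IsClosed.inter ?_ ?_))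
    · exact isClosed_le (f := fun _ => r) (g := fun z : ℝ × Ambient n => ‖z.2‖)
        (by fun_prop) (by fun_prop)
    · exact isClosed_le (f := fun z : ℝ × Ambient n => ‖z.2 - z.1 • p‖) (g := fun _ => ρ)
        (by fun_prop) (by fun_prop)
  have hsub : A ⊆ Icc 0 T ×ˢ closedBall 0 (ρ + T * ‖p‖) := by
    rintro ⟨s, x⟩ ⟨hs, -, -, h⟩
    refine ⟨hs, mem_closedBall_zero_iff.2 ?_⟩
    calc ‖x‖ = ‖(x - s • p) + s • p‖ := by simp
      _ ≤ ‖x - s • p‖ + ‖s • p‖ := norm_add_le _ _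
      _ ≤ ρ + T * ‖p‖ := by
        rw [norm_smul, Real.norm_of_nonneg hs.1]
        gcongr
        exact hs.2
  have hA : IsCompact A :=
    (isCompact_Icc.prod (isCompact_closedBall _ _)).of_isClosed_subset hclosed hsub
  obtain ⟨⟨s, x⟩, ⟨hs, hxS, hxr, hx⟩, hmin⟩ := hA.exists_isMinOn
    ⟨(T, q), ⟨hT, le_rfl⟩, hq, hqr, hqT⟩ continuous_fst.continuousOn
  refine ⟨s, ⟨hs.1.lt_of_ne ?_, hs.2⟩, x, hxS, hxr, hx, fun t ht y hy hyr => ?_⟩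
  · rintro rfl
    simp only [zero_smul, sub_zero] at hx
    linarith
  · by_contra! hle
    exact (hmin (show (t, y) ∈ A from ⟨⟨ht.1, ht.2.le.trans hs.2⟩, hy, hyr, hle⟩)).not_gt ht.2

/-- At the first touching the ball is touched from outside, and in its front half. -/
theorem norm_eq_and_inner_nonneg_of_first_touching {x p : Ambient n} {s ρ : ℝ} (hs : 0 < s)
    (hx : ‖x - s • p‖ ≤ ρ) (hfirst : ∀ t ∈ Ico 0 s, ρ < ‖x - t • p‖) :
    ‖x - s • p‖ = ρ ∧ 0 ≤ ⟪p, x - s • p⟫_ℝ := by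
  have hev : ∀ᶠ t in 𝓝[<] s, ρ < ‖x - t • p‖ := by
    filter_upwards [Ico_mem_nhdsLT hs] with t ht using hfirst t ht
  have htend : Tendsto (fun t : ℝ => ‖x - t • p‖) (𝓝[<] s) (𝓝 ‖x - s • p‖) := by
    have : Continuous fun t : ℝ => ‖x - t • p‖ := by fun_prop
    exact this.continuousAt.mono_left nhdsWithin_le_nhds
  have heq : ‖x - s • p‖ = ρ := hx.antisymm (ge_of_tendsto htend (hev.mono fun _ h => h.le))
  refine ⟨heq, ?_⟩
  -- This is the difference quotient of the squared distance to the moving centre; let `t → s`.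
  have hev₂ : ∀ᶠ t in 𝓝[<] s, 0 ≤ 2 * ⟪p, x - s • p⟫_ℝ + (s - t) * ‖p‖ ^ 2 := by
    filter_upwards [hev, self_mem_nhdsWithin] with t ht (hts : t < s)
    have h₁ : ‖x - t • p‖ ^ 2 =
        ‖x - s • p‖ ^ 2 + (s - t) * (2 * ⟪p, x - s • p⟫_ℝ + (s - t) * ‖p‖ ^ 2) := by
      have : x - t • p = (x - s • p) + (s - t) • p := by module
      rw [this, norm_add_sq_real, inner_smul_right, norm_smul, mul_pow, Real.norm_eq_abs, sq_abs,
        real_inner_comm]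
      ring
    have h₂ : ‖x - s • p‖ ^ 2 < ‖x - t • p‖ ^ 2 := by
      rw [heq]
      exact pow_lt_pow_left₀ ht (heq ▸ norm_nonneg _) two_ne_zero
    have h₃ : 0 < (s - t) * (2 * ⟪p, x - s • p⟫_ℝ + (s - t) * ‖p‖ ^ 2) := by linarith
    exact (pos_of_mul_pos_right h₃ (sub_pos.2 hts).le).le
  have htend₂ : Tendsto (fun t : ℝ => 2 * ⟪p, x - s • p⟫_ℝ + (s - t) * ‖p‖ ^ 2) (𝓝[<] s)
      (𝓝 (2 * ⟪p, x - s • p⟫_ℝ)) := by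
    have : Continuous fun t : ℝ => 2 * ⟪p, x - s • p⟫_ℝ + (s - t) * ‖p‖ ^ 2 := by fun_prop
    have := this.continuousAt (x := s) |>.mono_left (nhdsWithin_le_nhds (s := Iio s))
    simpa [ContinuousAt] using this
  have := ge_of_tendsto htend₂ hev₂
  linarith

end MovingSphere

theorem mainTheorem8 {n : ℕ} {M : Type*} [TopologicalSpace M]
    [ChartedSpace (EuclideanSpace ℝ (Fin n)) M] [IsManifold (𝓡 n) ∞ M]
    (F : M → Ambient n) (hF : IsProperlyImmersedSelfShrinker F) :
    ∀ r : ℝ, √(2 * (n : ℝ)) < r → range F \ ball 0 r ⊆ allowedRegion (range F) r := by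
  rintro r hr q ⟨hqF, hqr⟩ (hq | hq)
  · exact hqr hq
  simp only [shadowUnion, mem_iUnion] at hq
  obtain ⟨p, ⟨-, hempty⟩, -, y, ⟨T, hT, rfl⟩, hy⟩ := hq
  have hclosed : IsClosed (range F) := hF.proper.isClosed_range
  have hgap : ∀ z ∈ range F ∩ sphere 0 r, ∀ t ∈ Icc 0 T, √(2 * (n : ℝ)) < ‖z - t • p‖ := by
    intro z hz t ht
    by_contra! hle
    have hzr : ‖z‖ = r := mem_sphere_zero_iff_norm.1 hz.2
    have : z ∈ shadow r p ∩ (range F ∩ sphere 0 r) :=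
      ⟨⟨by simp [hzr], exists_mem_sphere_of_segment ht.1 (hzr ▸ hr.le) hle⟩, hz⟩
    simp [hempty] at this
  obtain ⟨ρ, hRρ, hρr, hρ⟩ := exists_radius_gt ((isCompact_sphere 0 r).inter_left hclosed) p hr hgap
  have hqT : ‖q - T • p‖ ≤ ρ := by
    have : ‖q - T • p‖ = √(2 * (n : ℝ)) := by simpa [← sub_eq_add_neg] using hy
    exact this ▸ hRρ.le
  obtain ⟨s, hs, _, ⟨m, rfl⟩, hxr, hx, hfirst⟩ :=
    exists_first_touching hclosed hρr hqF (by simpa using hqr) hT hqT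
  obtain ⟨heq, hfront⟩ := norm_eq_and_inner_nonneg_of_first_touching hs.1 hx
    fun t ht => hfirst t ht _ ⟨m, rfl⟩ hxr
  -- Contact off `S(0,r)` ensures that all nearby points of `M` also map outside `B(0,r)`, so the
  -- first-contact bound yields a local minimum on `M`.
  have hxr' : r < ‖F m‖ := by
    refine hxr.lt_of_ne fun h => ?_
    exact (hρ (F m) ⟨⟨m, rfl⟩, by simp [← h]⟩ s ⟨hs.1.le, hs.2⟩).not_ge hx
  have hmin : IsLocalMin (fun x => ‖F x - s • p‖ ^ 2) m := by
    have hnear : ∀ᶠ x in 𝓝 m, r < ‖F x‖ :=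
      (hF.smooth.continuous.norm.continuousAt).eventually (lt_mem_nhds hxr')
    filter_upwards [hnear] with x hxn
    have hle : ρ ≤ ‖F x - s • p‖ := by
      have hc : Continuous fun t : ℝ => ‖F x - t • p‖ := by fun_prop
      refine ge_of_tendsto (hc.continuousAt.mono_left (nhdsWithin_le_nhds (s := Iio s))) ?_
      filter_upwards [Ico_mem_nhdsLT hs.1] with t ht
      exact (hfirst t ht _ ⟨x, rfl⟩ hxn.le).le
    rw [heq]
    exact pow_le_pow_left₀ (heq ▸ norm_nonneg _) hle 2
  have hle := hF.inner_le_of_isLocalMin hmin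
  have hsplit : ⟪F m, F m - s • p⟫_ℝ = ρ ^ 2 + s * ⟪p, F m - s • p⟫_ℝ := by
    rw [← heq, ← real_inner_self_eq_norm_sq, ← real_inner_smul_left, ← inner_add_left,
      sub_add_cancel]
  have hlt : 2 * (n : ℝ) < ρ ^ 2 := Real.lt_sq_of_sqrt_lt hRρ
  nlinarith [mul_nonneg hs.1.le hfront]
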